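/- Let $\mathcal H$ be a finite-dimensional complex Hilbert space (inner product linear in the second argument), and let $\{p_i,\rho_i\}_{i=1}^m$ be an ensemble of linearly independent states of ranks $r_1,\dots,r_m$ on $\mathcal H$: $p_i>0$, $\sum_i p_i=1$, $\rho_i\ge 0$, $\operatorname{Tr}\rho_i=1$, $\operatorname{rank}\rho_i=r_i$, and the supports $\operatorname{supp}\rho_i$ are linearly independent subspaces which together span $\mathcal H$ (so $\sum_i r_i=\dim\mathcal H$). Let $\{\Pi_i\}_{i=1}^m$ be an optimal POVM for its minimum error discrimination, i.e. a POVM ($\Pi_i\ge0$, $\sum_i\Pi_i=\mathbb 1$) that maximizes $\sum_i p_i\operatorname{Tr}(\rho_i\Pi_i)$ over all $m$-element POVMs. Let $\psi_{ij}\in\mathcal H$ ($1\le i\le m$, $1\le j\le r_i$) be any vectors with $p_i\rho_i=\sum_{j=1}^{r_i}|\psi_{ij}\rangle\langle\psi_{ij}|$ for all $i$. Let $G$ be their Gram matrix, $G^{(l\,i)}_{k\,j}=\langle\psi_{lk},\psi_{ij}\rangle$, with positive square root $G^{1/2}$, and let $u_{ij}=\sum_{l,k}(G^{-1})^{(l\,i)}_{k\,j}\,\psi_{lk}$.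 For an $n\times n$ matrix $W$ ($n=\sum_i r_i$), partitioned into blocks of sizes $r_1,\dots,r_m$, let $w_{ij}=\sum_{l,k}(G^{1/2}W)^{(l\,i)}_{k\,j}\,u_{lk}$ and let $X^{(ii)}$ be the $i$-th diagonal block ($r_i\times r_i$) of $G^{1/2}W$. Call $W$ adapted if it is unitary, $\Pi_i=\sum_{j=1}^{r_i}|w_{ij}\rangle\langle w_{ij}|$ for all $i$, and $X^{(ii)}\ge0$ for all $i$. Then there is exactly one adapted $W$, and for it $X^{(ii)}>0$ for all $i$. Moreover, put $$\chi_{ij}=\sum_{k=1}^{r_i}X^{(ii)}_{kj}\,\psi_{ik},\qquad \sigma_i=\frac{\sum_{j}|\chi_{ij}\rangle\langle\chi_{ij}|}{\sum_{j}\|\chi_{ij}\|^2},\qquad q_i=\frac{\sum_{j}\|\chi_{ij}\|^2}{\sum_{l,k}\|\chi_{lk}\|^2}.$$ Then $\widetilde Q=\{q_i,\sigma_i\}_{i=1}^m$ is again an ensemble of linearly independent states of ranks $r_1,\dots,r_m$ on $\mathcal H$ (in the sense above), $\operatorname{supp}(q_i\sigma_i)=\operatorname{supp}(p_i\rho_i)$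 for all $i$, and $\{\Pi_i\}$ is the pretty good measurement of $\widetilde Q$: $$\Pi_i=\Big(\sum_{j}q_j\sigma_j\Big)^{-1/2}q_i\sigma_i\Big(\sum_{k}q_k\sigma_k\Big)^{-1/2},\qquad 1\le i\le m.$$ -/

import Mathlib

open scoped ComplexOrder MatrixOrder

noncomputable section

namespace MED

section Ensembles

variable {H : Type*} [NormedAddCommGroup H] [InnerProductSpace ℂ H]

/-- The (unnormalised) pure state `|v⟩⟨v|`. -/
def ketbra (v : H) : H →L[ℂ] H := InnerProductSpace.rankOne ℂ v v

/-- The support of a self-adjoint operator on a finite-dimensional space: its range, which is the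
orthogonal complement of its kernel. -/
def supp (A : H →L[ℂ] H) : Submodule ℂ H := LinearMap.range (A : H →ₗ[ℂ] H)

/-- The trace of an operator. -/
def tr (A : H →L[ℂ] H) : ℂ := LinearMap.trace ℂ H (A : H →ₗ[ℂ] H)

/-- `{p i, ρ i}` is an ensemble of linearly independent states of ranks `r i` on `H`: the `ρ i` are
density operators, the `p i` positive probabilities, and the supports of the `ρ i` are linearly
independent subspaces that together span `H`. -/
structure IsLIEnsemble {m : ℕ} (r : Fin m → ℕ) (p : Fin m → ℝ) (ρ : Fin m → H →L[ℂ] H) : Prop where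
  prob_pos : ∀ i, 0 < p i
  prob_sum : ∑ i, p i = 1
  pos : ∀ i, (ρ i).IsPositive
  trace_one : ∀ i, tr (ρ i) = 1
  rank_eq : ∀ i, Module.finrank ℂ (supp (ρ i)) = r i
  indep : iSupIndep fun i => supp (ρ i)
  span : ⨆ i, supp (ρ i) = ⊤

/-- An `m`-element POVM. -/
structure IsPOVM {m : ℕ} (E : Fin m → H →L[ℂ] H) : Prop where
  pos : ∀ i, (E i).IsPositive
  sum_eq : ∑ i, E i = 1

/-- The average probability of success `∑ i, p i Tr (ρ i E i)`; each trace is a real number when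
`ρ i` and `E i` are positive. -/
def successProb {m : ℕ} (p : Fin m → ℝ) (ρ E : Fin m → H →L[ℂ] H) : ℝ :=
  ∑ i, p i * (tr (ρ i * E i)).re

/-- `E` is an optimal POVM for the minimum error discrimination of `{p i, ρ i}`. -/
def IsOptimalPOVM {m : ℕ} (p : Fin m → ℝ) (ρ E : Fin m → H →L[ℂ] H) : Prop :=
  IsPOVM E ∧ ∀ F : Fin m → H →L[ℂ] H, IsPOVM F → successProb p ρ F ≤ successProb p ρ E

/-- The pretty good measurement `S ^ (-1/2) (q i σ i) S ^ (-1/2)`, where `S = ∑ j, q j σ j`. -/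
def pgm [CompleteSpace H] {m : ℕ} (q : Fin m → ℝ) (σ : Fin m → H →L[ℂ] H) (i : Fin m) :
    H →L[ℂ] H :=
  (∑ j, (q j : ℂ) • σ j) ^ (-1 / 2 : ℝ) * ((q i : ℂ) • σ i) *
    (∑ j, (q j : ℂ) • σ j) ^ (-1 / 2 : ℝ)

end Ensembles

section Construction

variable {H : Type*} [NormedAddCommGroup H] [InnerProductSpace ℂ H] {m : ℕ} {r : Fin m → ℕ}

/-- Two-tier indices: the block index `i` and the index `j` inside the block of size `r i`. -/
abbrev Idx {m : ℕ} (r : Fin m → ℕ) : Type := Σ i : Fin m, Fin (r i)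

/-- The vectors `ψ` decompose the unnormalised states: `p i ρ i = ∑ j, |ψ i j⟩⟨ψ i j|`. -/
def IsDecomposition (p : Fin m → ℝ) (ρ : Fin m → H →L[ℂ] H) (ψ : Idx r → H) : Prop :=
  ∀ i, (p i : ℂ) • ρ i = ∑ j : Fin (r i), ketbra (ψ ⟨i, j⟩)

/-- The Gram matrix `G` of the vectors `ψ`. -/
def G (ψ : Idx r → H) : Matrix (Idx r) (Idx r) ℂ := Matrix.gram ℂ ψ

/-- The system `u` biorthogonal to `ψ`: `u b = ∑ a, (G⁻¹) a b • ψ a`. -/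
def dualVec (ψ : Idx r → H) (b : Idx r) : H := ∑ a, (G ψ)⁻¹ a b • ψ a

/-- The matrix `G ^ (1/2) W`, with the positive square root of `G`. -/
def rootMul (ψ : Idx r → H) (W : Matrix (Idx r) (Idx r) ℂ) : Matrix (Idx r) (Idx r) ℂ :=
  CFC.sqrt (G ψ) * W

/-- The vectors `w b = ∑ a, (G ^ (1/2) W) a b • u a`. -/
def measVec (ψ : Idx r → H) (W : Matrix (Idx r) (Idx r) ℂ) (b : Idx r) : H :=
  ∑ a, rootMul ψ W a b • dualVec ψ a

/-- The `i`-th diagonal block of `G ^ (1/2) W`. -/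
def X (ψ : Idx r → H) (W : Matrix (Idx r) (Idx r) ℂ) (i : Fin m) :
    Matrix (Fin (r i)) (Fin (r i)) ℂ :=
  Matrix.blockDiag' (rootMul ψ W) i

/-- `W` is a unitary matrix which represents the measurement `E`, that is
`E i = ∑ j, |w i j⟩⟨w i j|`, and for which the diagonal blocks of `G ^ (1/2) W` are positive
semidefinite. -/
structure IsAdapted (ψ : Idx r → H) (E : Fin m → H →L[ℂ] H) (W : Matrix (Idx r) (Idx r) ℂ) :
    Prop where
  unitary : W ∈ Matrix.unitaryGroup (Idx r) ℂ
  resolves : ∀ i, E i = ∑ j : Fin (r i), ketbra (measVec ψ W ⟨i, j⟩)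
  posSemidef : ∀ i, (X ψ W i).PosSemidef

/-- The vectors `χ i j = ∑ k, (X i) k j • ψ i k`. -/
def chi (ψ : Idx r → H) (W : Matrix (Idx r) (Idx r) ℂ) (i : Fin m) (j : Fin (r i)) : H :=
  ∑ k : Fin (r i), X ψ W i k j • ψ ⟨i, k⟩

/-- The weight `∑ j, ⟨χ i j, χ i j⟩`. -/
def weight (ψ : Idx r → H) (W : Matrix (Idx r) (Idx r) ℂ) (i : Fin m) : ℝ :=
  ∑ j : Fin (r i), ‖chi ψ W i j‖ ^ 2

/-- The states `σ i` of the associated ensemble. -/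
def sigma (ψ : Idx r → H) (W : Matrix (Idx r) (Idx r) ℂ) (i : Fin m) : H →L[ℂ] H :=
  ((weight ψ W i : ℂ))⁻¹ • ∑ j : Fin (r i), ketbra (chi ψ W i j)

/-- The probabilities `q i` of the associated ensemble. -/
def q (ψ : Idx r → H) (W : Matrix (Idx r) (Idx r) ℂ) (i : Fin m) : ℝ :=
  weight ψ W i / ∑ l, weight ψ W l

end Construction

end MED

end

/-!
Comparing the optimal measurement `E` with those obtained by first filtering the system through
`1 - ε |v⟩⟨v|` yields a positive invertible operator `Z` with `p i ρ i ≤ Z` and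
`Z E i = p i ρ i E i`. If `E i = ∑ j, |w i j⟩⟨w i j|`, then
`Z (w i j) = p i ρ i (w i j) = ∑ k, ⟨ψ i k, w i j⟩ ψ i k = χ i j`, so the vectors `w i j` can be
recovered from the matrix `X i = (⟨ψ i k, w i j⟩)`. Since `X i (X i)*` is the matrix of `E i` in
the family `ψ i k`, requiring `X i ≥ 0` leaves only its positive square root: this singles out `w`,
and with it `W`. Finally `∑ j, |χ i j⟩⟨χ i j| = Z E i Z`, and these operators sum to `Z ^ 2`, so
that `E` is the pretty good measurement of the ensemble proportional to them.
-/

namespace MED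

section Operators

variable {H : Type*} [NormedAddCommGroup H] [InnerProductSpace ℂ H] {ι : Type*} [Fintype ι]

lemma ketbra_apply (v x : H) : ketbra v x = inner ℂ v x • v := rfl

lemma isPositive_ketbra (v : H) : (ketbra v).IsPositive :=
  InnerProductSpace.isPositive_rankOne_self v

lemma ketbra_mul_self (v : H) : ketbra v * ketbra v = ((‖v‖ ^ 2 : ℝ) : ℂ) • ketbra v := by
  ext x
  simp [ketbra_apply, smul_smul, mul_comm]

lemma isPositive_sum_ketbra (v : ι → H) : (∑ j, ketbra (v j)).IsPositive :=
  ContinuousLinearMap.isPositive_sum _ fun j _ => isPositive_ketbra (v j)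

lemma sum_ketbra_apply (v : ι → H) (x : H) :
    (∑ j, ketbra (v j)) x = ∑ j, inner ℂ (v j) x • v j := by
  simp [ketbra_apply]

lemma inner_sum_ketbra_apply (v : ι → H) (x y : H) :
    inner ℂ x ((∑ j, ketbra (v j)) y) = ∑ j, inner ℂ x (v j) * inner ℂ (v j) y := by
  simp only [sum_ketbra_apply, inner_sum, inner_smul_right, mul_comm]

lemma inner_sum_ketbra_apply_self (v : ι → H) (x : H) :
    inner ℂ x ((∑ j, ketbra (v j)) x) = (∑ j, ‖inner ℂ (v j) x‖ ^ 2 : ℝ) := by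
  simp only [inner_sum_ketbra_apply, Complex.ofReal_sum]
  refine Finset.sum_congr rfl fun j _ => ?_
  rw [← inner_conj_symm, Complex.conj_mul', Complex.ofReal_pow]

lemma inner_eq_zero_of_re_inner_sum_ketbra_nonpos {v : ι → H} {x : H}
    (hx : (inner ℂ x ((∑ j, ketbra (v j)) x)).re ≤ 0) (j : ι) : inner ℂ (v j) x = 0 := by
  rw [inner_sum_ketbra_apply_self, Complex.ofReal_re] at hx
  have hsq : ∀ j ∈ Finset.univ, 0 ≤ ‖inner ℂ (v j) x‖ ^ 2 := fun j _ => sq_nonneg _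
  simpa using (Finset.sum_eq_zero_iff_of_nonneg hsq).1
    (hx.antisymm (Finset.sum_nonneg hsq)) j (Finset.mem_univ j)

lemma supp_smul {c : ℂ} (hc : c ≠ 0) (A : H →L[ℂ] H) : supp (c • A) = supp A := by
  simpa [supp] using LinearMap.range_smul (A : H →ₗ[ℂ] H) c hc

lemma tr_add (A B : H →L[ℂ] H) : tr (A + B) = tr A + tr B := by simp [tr]

lemma tr_sub (A B : H →L[ℂ] H) : tr (A - B) = tr A - tr B := by simp [tr]

lemma tr_smul (c : ℂ) (A : H →L[ℂ] H) : tr (c • A) = c * tr A := by simp [tr]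

lemma tr_sum (A : ι → H →L[ℂ] H) : tr (∑ i, A i) = ∑ i, tr (A i) := by simp [tr]

lemma tr_mul_comm (A B : H →L[ℂ] H) : tr (A * B) = tr (B * A) :=
  LinearMap.trace_mul_comm ℂ (A : H →ₗ[ℂ] H) (B : H →ₗ[ℂ] H)

section FiniteDimensional

variable [FiniteDimensional ℂ H]

lemma tr_mul_ketbra (A : H →L[ℂ] H) (v : H) : tr (A * ketbra v) = inner ℂ v (A v) := by
  rw [ketbra, ContinuousLinearMap.mul_def, InnerProductSpace.comp_rankOne, tr,
    InnerProductSpace.trace_rankOne]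

lemma tr_ketbra (v : H) : tr (ketbra v) = (‖v‖ ^ 2 : ℝ) := by
  simpa using tr_mul_ketbra 1 v

lemma exists_eq_sum_ketbra {A : H →L[ℂ] H} (hA : A.IsPositive) :
    ∃ (n : ℕ) (v : Fin n → H), A = ∑ j, ketbra (v j) :=
  ContinuousLinearMap.isPositive_iff_eq_sum_rankOne.1 hA

lemma apply_eq_zero_of_re_inner_nonpos {A : H →L[ℂ] H} (hA : A.IsPositive) {x : H}
    (hx : (inner ℂ x (A x)).re ≤ 0) : A x = 0 := by
  obtain ⟨n, v, rfl⟩ := exists_eq_sum_ketbra hA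
  simp only [sum_ketbra_apply, inner_eq_zero_of_re_inner_sum_ketbra_nonpos hx, zero_smul,
    Finset.sum_const_zero]

lemma tr_mul_sum_ketbra (A : H →L[ℂ] H) (v : ι → H) :
    tr (A * ∑ j, ketbra (v j)) = ∑ j, inner ℂ (v j) (A (v j)) := by
  rw [Finset.mul_sum, tr_sum]
  exact Finset.sum_congr rfl fun j _ => tr_mul_ketbra A (v j)

lemma re_tr_mul_nonneg {A B : H →L[ℂ] H} (hA : A.IsPositive) (hB : B.IsPositive) :
    0 ≤ (tr (A * B)).re := by
  obtain ⟨n, v, rfl⟩ := exists_eq_sum_ketbra hB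
  rw [tr_mul_sum_ketbra, Complex.re_sum]
  exact Finset.sum_nonneg fun j _ => hA.re_inner_nonneg_right (v j)

lemma mul_eq_zero_of_re_tr_mul_eq_zero {A B : H →L[ℂ] H} (hA : A.IsPositive) (hB : B.IsPositive)
    (h : (tr (A * B)).re = 0) : A * B = 0 := by
  obtain ⟨n, v, rfl⟩ := exists_eq_sum_ketbra hB
  have hnonneg : ∀ j ∈ Finset.univ, 0 ≤ (inner ℂ (v j) (A (v j))).re :=
    fun j _ => hA.re_inner_nonneg_right (v j)
  rw [tr_mul_sum_ketbra, Complex.re_sum, Finset.sum_eq_zero_iff_of_nonneg hnonneg] at h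
  have hAv : ∀ j, A (v j) = 0 := fun j =>
    apply_eq_zero_of_re_inner_nonpos hA (h j (Finset.mem_univ j)).le
  ext x
  simp only [mul_apply_eq_comp, sum_ketbra_apply, map_sum, map_smul, hAv, smul_zero,
    Finset.sum_const_zero, zero_apply]

lemma supp_sum_ketbra (v : ι → H) :
    supp (∑ j, ketbra (v j)) = Submodule.span ℂ (Set.range v) := by
  apply le_antisymm
  · rintro _ ⟨x, rfl⟩
    rw [ContinuousLinearMap.coe_coe, sum_ketbra_apply]
    exact Submodule.sum_mem _ fun j _ => Submodule.smul_mem _ _ (Submodule.subset_span ⟨j, rfl⟩)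
  · have horth := (isPositive_sum_ketbra v).isSymmetric.orthogonal_range
    rw [supp, ← Submodule.orthogonal_orthogonal (LinearMap.range _), horth, Submodule.span_le]
    rintro _ ⟨j, rfl⟩
    refine (Submodule.mem_orthogonal' _ _).2 fun x hx => ?_
    have hx0 : (∑ j, ketbra (v j)) x = 0 := hx
    exact inner_eq_zero_of_re_inner_sum_ketbra_nonpos (by simp [hx0]) j

lemma linearIndependent_of_sum_ketbra_eq_one {v : ι → H}
    (hcard : Fintype.card ι = Module.finrank ℂ H) (hv : ∑ j, ketbra (v j) = 1) :
    LinearIndependent ℂ v := by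
  refine linearIndependent_of_top_le_span_of_card_eq_finrank (top_le_iff.2 ?_) hcard
  rw [← supp_sum_ketbra, hv, supp]
  exact LinearMap.range_id

end FiniteDimensional

variable [CompleteSpace H]

lemma mul_ketbra_mul {A : H →L[ℂ] H} (hA : IsSelfAdjoint A) (v : H) :
    A * ketbra v * A = ketbra (A v) := by
  rw [ketbra, ContinuousLinearMap.mul_def, ContinuousLinearMap.mul_def,
    InnerProductSpace.comp_rankOne, InnerProductSpace.rankOne_comp, hA.adjoint_eq, ketbra]

lemma mul_sum_ketbra_mul {A : H →L[ℂ] H} (hA : IsSelfAdjoint A) (v : ι → H) :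
    A * (∑ j, ketbra (v j)) * A = ∑ j, ketbra (A (v j)) := by
  simp only [Finset.mul_sum, Finset.sum_mul, mul_ketbra_mul hA]

lemma re_tr_star [FiniteDimensional ℂ H] (A : H →L[ℂ] H) : (tr (star A)).re = (tr A).re := by
  simp only [tr, LinearMap.trace_eq_sum_inner _ (stdOrthonormalBasis ℂ H), Complex.re_sum,
    ContinuousLinearMap.coe_coe, ContinuousLinearMap.star_eq_adjoint,
    ContinuousLinearMap.adjoint_inner_right]
  exact Finset.sum_congr rfl fun i _ => inner_re_symm (𝕜 := ℂ) _ _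

end Operators

section Optimality

open ComplexStarModule Filter Topology

variable {H : Type*} [NormedAddCommGroup H] [InnerProductSpace ℂ H] {m : ℕ}
  {R E : Fin m → H →L[ℂ] H}

/-- `Z` is a Lagrange operator certifying the optimality of `E` for the maximisation of
`∑ i, Re Tr (R i * F i)` over the POVMs `F`: it solves the dual problem of minimising `Tr Z` under
`R i ≤ Z`, with complementary slackness `(Z - R i) * E i = 0`. -/
structure IsLagrangeOperator (R E : Fin m → H →L[ℂ] H) (Z : H →L[ℂ] H) : Prop where
  le : ∀ i, R i ≤ Z
  mul_eq : ∀ i, Z * E i = R i * E i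

lemma IsLagrangeOperator.isPositive {Z : H →L[ℂ] H} [Nonempty (Fin m)]
    (hZ : IsLagrangeOperator R E Z) (hR : ∀ i, (R i).IsPositive) : Z.IsPositive := by
  obtain ⟨i⟩ := ‹Nonempty (Fin m)›
  rw [← ContinuousLinearMap.nonneg_iff_isPositive]
  exact ((R i).nonneg_iff_isPositive.2 (hR i)).trans (hZ.le i)

variable [CompleteSpace H]

/-- The measurement which first applies the filter `K`: it measures `E` if the filter lets the
system pass and guesses the outcome `k` otherwise. Filters `K` close to `1` give the variations of
`E` from which the optimality conditions are read off. -/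
noncomputable def filtered (E : Fin m → H →L[ℂ] H) (K : H →L[ℂ] H) (k i : Fin m) : H →L[ℂ] H :=
  star K * E i * K + if i = k then 1 - star K * K else 0

lemma isPOVM_filtered (hE : IsPOVM E) {K : H →L[ℂ] H} (hK : star K * K ≤ 1) (k : Fin m) :
    IsPOVM (filtered E K k) where
  pos i := by
    refine ((hE.pos i).adjoint_conj K).add ?_
    split_ifs
    · exact hK
    · exact ContinuousLinearMap.isPositive_zero
  sum_eq := by
    simp only [filtered, Finset.sum_add_distrib, Finset.sum_ite_eq', Finset.mem_univ, if_true]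
    rw [← Finset.sum_mul, ← Finset.mul_sum, hE.sum_eq, mul_one, add_sub_cancel]

lemma isSelfAdjoint_one_sub_smul {B : H →L[ℂ] H} (hB : IsSelfAdjoint B) (ε : ℝ) :
    IsSelfAdjoint (1 - (ε : ℂ) • B) :=
  (IsSelfAdjoint.one _).sub (IsSelfAdjoint.smul (Complex.conj_ofReal ε) hB)

lemma star_one_sub_smul_ketbra_mul_self_le_one {v : H} {ε : ℝ} (h0 : 0 ≤ ε)
    (h2 : ε * ‖v‖ ^ 2 ≤ 2) :
    star (1 - (ε : ℂ) • ketbra v) * (1 - (ε : ℂ) • ketbra v) ≤ 1 := by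
  have hdiff : 1 - (1 - (ε : ℂ) • ketbra v) * (1 - (ε : ℂ) • ketbra v) =
      ((ε * (2 - ε * ‖v‖ ^ 2) : ℝ) : ℂ) • ketbra v := by
    simp only [mul_sub, sub_mul, mul_one, one_mul, smul_mul_assoc, mul_smul_comm, ketbra_mul_self]
    push_cast
    module
  rw [(isSelfAdjoint_one_sub_smul (isPositive_ketbra v).isSelfAdjoint ε).star_eq,
    ContinuousLinearMap.le_def, hdiff]
  refine (isPositive_ketbra v).smul_of_nonneg ?_
  exact_mod_cast mul_nonneg h0 (sub_nonneg.2 h2)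

variable [FiniteDimensional ℂ H]

lemma re_tr_mul_conj_one_sub_smul {R E B : H →L[ℂ] H} (hR : IsSelfAdjoint R)
    (hE : IsSelfAdjoint E) (hB : IsSelfAdjoint B) (ε : ℝ) :
    (tr (R * ((1 - (ε : ℂ) • B) * E * (1 - (ε : ℂ) • B)))).re =
      (tr (R * E)).re - 2 * ε * (tr (R * E * B)).re + ε ^ 2 * (tr (R * (B * E * B))).re := by
  have hswap : (tr (R * (B * E))).re = (tr (R * E * B)).re := by
    rw [tr_mul_comm, ← re_tr_star]
    simp only [star_mul, hR.star_eq, hE.star_eq, hB.star_eq, mul_assoc]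
  have hexpand : R * ((1 - (ε : ℂ) • B) * E * (1 - (ε : ℂ) • B)) =
      R * E - (ε : ℂ) • (R * (B * E)) - (ε : ℂ) • (R * E * B) +
        ((ε ^ 2 : ℝ) : ℂ) • (R * (B * E * B)) := by
    simp only [mul_sub, sub_mul, mul_one, one_mul, smul_mul_assoc, mul_smul_comm, mul_assoc]
    push_cast
    module
  rw [hexpand]
  simp only [tr_add, tr_sub, tr_smul, Complex.add_re, Complex.sub_re, Complex.re_ofReal_mul, hswap]
  ring

lemma re_tr_realPart_mul (T : H →L[ℂ] H) {B : H →L[ℂ] H} (hB : IsSelfAdjoint B) :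
    (tr ((ℜ T : H →L[ℂ] H) * B)).re = (tr (T * B)).re := by
  have hstar : (tr (star T * B)).re = (tr (T * B)).re := by
    rw [tr_mul_comm, ← re_tr_star]
    simp only [star_mul, star_star, hB.star_eq]
  have hre : (ℜ T : H →L[ℂ] H) = ((2⁻¹ : ℝ) : ℂ) • (T + star T) := by
    rw [realPart_apply_coe, Complex.coe_smul]
  rw [hre, smul_mul_assoc, add_mul, tr_smul, tr_add, Complex.re_ofReal_mul, Complex.add_re, hstar]
  ring

lemma sum_re_tr_mul_filtered (hR : ∀ i, IsSelfAdjoint (R i)) (hE : ∀ i, IsSelfAdjoint (E i))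
    {B : H →L[ℂ] H} (hB : IsSelfAdjoint B) (k : Fin m) (ε : ℝ) :
    ∑ i, (tr (R i * filtered E (1 - (ε : ℂ) • B) k i)).re = ∑ i, (tr (R i * E i)).re -
      2 * ε * ((tr ((∑ i, R i * E i) * B)).re - (tr (R k * B)).re) +
      ε ^ 2 * (∑ i, (tr (R i * (B * E i * B))).re - (tr (R k * (B * B))).re) := by
  have hfail := re_tr_mul_conj_one_sub_smul (hR k) (IsSelfAdjoint.one _) hB ε
  have hterm : ∀ i, (tr (R i * filtered E (1 - (ε : ℂ) • B) k i)).re =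
      (tr (R i * E i)).re - 2 * ε * (tr (R i * E i * B)).re +
        ε ^ 2 * (tr (R i * (B * E i * B))).re +
        if i = k then 2 * ε * (tr (R k * B)).re - ε ^ 2 * (tr (R k * (B * B))).re else 0 := by
    intro i
    rw [filtered, (isSelfAdjoint_one_sub_smul hB ε).star_eq, mul_add, tr_add, Complex.add_re,
      re_tr_mul_conj_one_sub_smul (hR i) (hE i) hB]
    congr 1
    split_ifs with hik
    · subst hik
      simp only [mul_one] at hfail
      rw [mul_sub, mul_one, tr_sub, Complex.sub_re, hfail]
      ring
    · simp [tr]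
  simp only [hterm, Finset.sum_add_distrib, Finset.sum_sub_distrib, ← Finset.mul_sum,
    Finset.sum_ite_eq', Finset.mem_univ, if_true, Finset.sum_mul, tr_sum, Complex.re_sum]
  ring

lemma re_tr_mul_ketbra_le (hR : ∀ i, IsSelfAdjoint (R i)) (hE : IsPOVM E)
    (hopt : ∀ F, IsPOVM F → ∑ i, (tr (R i * F i)).re ≤ ∑ i, (tr (R i * E i)).re) (k : Fin m)
    (v : H) : (tr (R k * ketbra v)).re ≤ (tr ((∑ i, R i * E i) * ketbra v)).re := by
  rw [← sub_nonpos]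
  set gain := (tr (R k * ketbra v)).re - (tr ((∑ i, R i * E i) * ketbra v)).re
  set curv := ∑ i, (tr (R i * (ketbra v * E i * ketbra v))).re -
    (tr (R k * (ketbra v * ketbra v))).re
  have hsmall : ∀ᶠ ε in 𝓝[>] (0 : ℝ), ε * ‖v‖ ^ 2 ≤ 2 :=
    (((continuous_mul_const (‖v‖ ^ 2)).tendsto' 0 0 (zero_mul _)).eventually_le_const
      two_pos).filter_mono nhdsWithin_le_nhds
  have hvar : ∀ᶠ ε in 𝓝[>] (0 : ℝ), 2 * gain ≤ ε * -curv := by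
    filter_upwards [hsmall, self_mem_nhdsWithin] with ε hε hpos
    have hsum := hopt _ (isPOVM_filtered hE
      (star_one_sub_smul_ketbra_mul_self_le_one (le_of_lt hpos) hε) k)
    rw [sum_re_tr_mul_filtered hR (fun i => (hE.pos i).isSelfAdjoint)
      (isPositive_ketbra v).isSelfAdjoint k ε] at hsum
    refine le_of_mul_le_mul_left ?_ hpos
    linarith
  have hlim : Tendsto (fun ε : ℝ => ε * -curv) (𝓝[>] 0) (𝓝 0) :=
    ((continuous_mul_const (-curv)).tendsto' 0 0 (zero_mul _)).mono_left nhdsWithin_le_nhds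
  linarith [ge_of_tendsto hlim hvar]

theorem exists_isLagrangeOperator (hR : ∀ i, IsSelfAdjoint (R i)) (hE : IsPOVM E)
    (hopt : ∀ F, IsPOVM F → ∑ i, (tr (R i * F i)).re ≤ ∑ i, (tr (R i * E i)).re) :
    ∃ Z, IsLagrangeOperator R E Z := by
  -- Optimality forces `∑ i, R i * E i` to be self-adjoint; taking the real part avoids proving it.
  set Z : H →L[ℂ] H := ↑(ℜ (∑ i, R i * E i)) with hZ
  have hZR : ∀ i, (Z - R i).IsPositive := by
    intro i
    refine (ContinuousLinearMap.isPositive_def' ..).2 ⟨(ℜ _).2.sub (hR i), fun v => ?_⟩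
    have hle := re_tr_mul_ketbra_le hR hE hopt i v
    rw [← re_tr_realPart_mul (∑ i, R i * E i) (isPositive_ketbra v).isSelfAdjoint, ← hZ,
      ← sub_nonneg, ← Complex.sub_re, ← tr_sub, ← sub_mul, tr_mul_ketbra] at hle
    rwa [ContinuousLinearMap.reApplyInnerSelf_apply, ← inner_re_symm]
  have hsum : ∑ i, (tr ((Z - R i) * E i)).re = 0 := by
    have htr := re_tr_realPart_mul (∑ i, R i * E i) (IsSelfAdjoint.one (H →L[ℂ] H))
    rw [← hZ, mul_one, mul_one, tr_sum, Complex.re_sum] at htr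
    simp only [sub_mul, tr_sub, Complex.sub_re, Finset.sum_sub_distrib]
    rw [← Complex.re_sum, ← tr_sum, ← Finset.mul_sum, hE.sum_eq, mul_one, htr, sub_self]
  rw [Finset.sum_eq_zero_iff_of_nonneg fun i _ => re_tr_mul_nonneg (hZR i) (hE.pos i)] at hsum
  refine ⟨Z, fun i => hZR i, fun i => sub_eq_zero.1 ?_⟩
  rw [← sub_mul]
  exact mul_eq_zero_of_re_tr_mul_eq_zero (hZR i) (hE.pos i) (hsum i (Finset.mem_univ i))

lemma IsLagrangeOperator.isUnit {Z : H →L[ℂ] H} (hZ : IsLagrangeOperator R E Z)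
    (hR : ∀ i, (R i).IsPositive) (hsupp : ⨆ i, supp (R i) = ⊤) : IsUnit Z := by
  have hinj : Function.Injective Z := by
    refine (injective_iff_map_eq_zero Z).2 fun x hx => ?_
    have hRx : ∀ i, R i x = 0 := fun i => by
      refine apply_eq_zero_of_re_inner_nonpos (hR i) ?_
      simpa [hx] using (hZ.le i).re_inner_nonneg_right x
    have horth : ∀ i, supp (R i) ≤ (Submodule.span ℂ {x})ᗮ := by
      rintro i _ ⟨y, rfl⟩
      rw [Submodule.mem_orthogonal_singleton_iff_inner_right]
      exact ((hR i).isSymmetric x y).symm.trans (by simp [hRx])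
    have htop := top_le_iff.1 (hsupp ▸ iSup_le horth)
    simpa using htop
  exact ContinuousLinearMap.isUnit_iff_bijective.2
    ⟨hinj, LinearMap.surjective_of_injective (f := (Z : H →ₗ[ℂ] H)) hinj⟩

end Optimality

section PolarFactorization

open scoped Matrix

variable {H : Type*} [NormedAddCommGroup H] [InnerProductSpace ℂ H] {ι κ : Type*}

/-- The matrix of inner products `⟨φ k, v j⟩` between two families of vectors. In particular
`crossGram φ (A ∘ φ)` is the matrix of the sesquilinear form of the operator `A` in the
family `φ`. -/
noncomputable def crossGram (φ : ι → H) (v : κ → H) : Matrix ι κ ℂ :=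
  Matrix.of fun k j => inner ℂ (φ k) (v j)

lemma crossGram_mul_conjTranspose [Fintype κ] (φ : ι → H) (v : κ → H) :
    crossGram φ v * (crossGram φ v)ᴴ = crossGram φ (⇑(∑ j, ketbra (v j)) ∘ φ) := by
  ext k l
  simp only [crossGram, Matrix.mul_apply, Matrix.conjTranspose_apply, Matrix.of_apply,
    Function.comp_apply, inner_sum_ketbra_apply, RCLike.star_def, inner_conj_symm]

lemma crossGram_injective {φ : ι → H} (hφ : Submodule.span ℂ (Set.range φ) = ⊤) :
    Function.Injective (crossGram φ : (κ → H) → Matrix ι κ ℂ) := by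
  intro v w hvw
  funext j
  rw [← sub_eq_zero]
  have horth : Submodule.span ℂ (Set.range φ) ≤ (Submodule.span ℂ {v j - w j})ᗮ := by
    rw [Submodule.span_le]
    rintro _ ⟨k, rfl⟩
    rw [SetLike.mem_coe, Submodule.mem_orthogonal_singleton_iff_inner_left, inner_sub_right]
    exact sub_eq_zero.2 (congrFun₂ hvw k j)
  have hself : v j - w j ∈ (Submodule.span ℂ {v j - w j})ᗮ := horth (hφ ▸ Submodule.mem_top)
  exact inner_self_eq_zero.1 (Submodule.mem_orthogonal_singleton_iff_inner_right.1 hself)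

lemma posSemidef_crossGram_comp [Finite ι] [FiniteDimensional ℂ H] {A : H →L[ℂ] H}
    (hA : A.IsPositive) (φ : ι → H) : (crossGram φ (A ∘ φ)).PosSemidef := by
  obtain ⟨n, v, rfl⟩ := exists_eq_sum_ketbra hA
  rw [← crossGram_mul_conjTranspose]
  exact Matrix.posSemidef_self_mul_conjTranspose _

section Fintype

variable [Fintype ι]

lemma sum_ketbra_sum_smul [Fintype κ] (φ : ι → H) (Y : Matrix ι κ ℂ) :
    ∑ j, ketbra (∑ k, Y k j • φ k) =
      ∑ k, ∑ l, (Y * Yᴴ) k l • InnerProductSpace.rankOne ℂ (φ k) (φ l) := by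
  have hketbra : ∀ j, ketbra (∑ k, Y k j • φ k) =
      ∑ k, ∑ l, (Y k j * star (Y l j)) • InnerProductSpace.rankOne ℂ (φ k) (φ l) := fun j => by
    simp only [ketbra, map_sum, map_smul, map_smulₛₗ, sum_apply, smul_apply, Finset.smul_sum,
      smul_smul, starRingEnd_apply]
    rw [Finset.sum_comm]
    simp only [mul_comm]
  simp only [hketbra, Matrix.mul_apply, Matrix.conjTranspose_apply, Finset.sum_smul]
  rw [Finset.sum_comm]
  exact Finset.sum_congr rfl fun k _ => Finset.sum_comm

lemma sum_ketbra_mul_mul_sum_ketbra (φ : ι → H) (A : H →L[ℂ] H) :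
    (∑ k, ketbra (φ k)) * A * ∑ l, ketbra (φ l) =
      ∑ k, ∑ l, crossGram φ (A ∘ φ) k l • InnerProductSpace.rankOne ℂ (φ k) (φ l) := by
  simp only [Finset.sum_mul, Finset.mul_sum]
  rw [Finset.sum_comm]
  refine Finset.sum_congr rfl fun k _ => Finset.sum_congr rfl fun l _ => ?_
  rw [mul_assoc, ketbra, ketbra, ContinuousLinearMap.mul_def, ContinuousLinearMap.mul_def,
    InnerProductSpace.comp_rankOne, InnerProductSpace.rankOne_comp_rankOne]
  rfl

/-- A factorisation `A = ∑ j, |v j⟩⟨v j|` of a positive operator, normalised with respect to the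
family `φ`: the factors `v` of `A` are determined up to a unitary matrix only, and requiring the
matrix `⟨φ k, v j⟩` to be positive semidefinite selects one of them, as in the polar
decomposition. -/
structure IsPolarFactorization (φ : ι → H) (A : H →L[ℂ] H) (v : ι → H) : Prop where
  eq_sum : A = ∑ j, ketbra (v j)
  posSemidef : (crossGram φ v).PosSemidef

lemma IsPolarFactorization.crossGram_mul_self {φ v : ι → H} {A : H →L[ℂ] H}
    (hv : IsPolarFactorization φ A v) :
    crossGram φ v * crossGram φ v = crossGram φ (A ∘ φ) := by
  rw [hv.eq_sum, ← crossGram_mul_conjTranspose, hv.posSemidef.isHermitian.eq]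

lemma apply_eq_sum_crossGram_smul [FiniteDimensional ℂ H] [Fintype κ] {Z : H →L[ℂ] H}
    {φ : ι → H} {v : κ → H}
    (hZ : Z * (∑ j, ketbra (v j)) = (∑ k, ketbra (φ k)) * ∑ j, ketbra (v j)) (j : κ) :
    Z (v j) = ∑ k, crossGram φ v k j • φ k := by
  obtain ⟨x, hx⟩ : v j ∈ supp (∑ j, ketbra (v j)) := by
    rw [supp_sum_ketbra]
    exact Submodule.subset_span ⟨j, rfl⟩
  have hZx := congrArg (· x) hZ
  rw [ContinuousLinearMap.coe_coe] at hx
  simp only [mul_apply_eq_comp, hx] at hZx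
  rw [hZx, sum_ketbra_apply]
  rfl

variable [FiniteDimensional ℂ H] {φ : ι → H} {A Z : H →L[ℂ] H}

lemma IsPolarFactorization.eq {v w : ι → H} (hZ : Function.Injective Z)
    (hZA : Z * A = (∑ k, ketbra (φ k)) * A) (hv : IsPolarFactorization φ A v)
    (hw : IsPolarFactorization φ A w) : v = w := by
  classical
  have hcross : crossGram φ v = crossGram φ w :=
    (CFC.mul_self_eq_mul_self_iff _ _ hv.posSemidef.nonneg hw.posSemidef.nonneg).1
      (hv.crossGram_mul_self.trans hw.crossGram_mul_self.symm)
  funext j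
  refine hZ ?_
  rw [apply_eq_sum_crossGram_smul (hv.eq_sum ▸ hZA), hcross,
    ← apply_eq_sum_crossGram_smul (hw.eq_sum ▸ hZA)]

variable [CompleteSpace H]

lemma exists_isPolarFactorization (hφ : LinearIndependent ℂ φ) (hA : A.IsPositive)
    (hZ : IsSelfAdjoint Z) (hu : IsUnit Z) (hZA : Z * A = (∑ k, ketbra (φ k)) * A) :
    ∃ v, IsPolarFactorization φ A v := by
  classical
  set Y := CFC.sqrt (crossGram φ (A ∘ φ))
  have hY : Y.PosSemidef := Matrix.nonneg_iff_posSemidef.1 (CFC.sqrt_nonneg _)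
  have hYY : Y * Yᴴ = crossGram φ (A ∘ φ) := by
    rw [hY.isHermitian.eq]
    exact CFC.sqrt_mul_sqrt_self _ (posSemidef_crossGram_comp hA φ).nonneg
  choose v hv using fun j =>
    (ContinuousLinearMap.isUnit_iff_bijective.1 hu).surjective (∑ k, Y k j • φ k)
  have hAZ : A * Z = A * ∑ k, ketbra (φ k) := by
    simpa only [star_mul, hZ.star_eq, hA.isSelfAdjoint.star_eq,
      (isPositive_sum_ketbra φ).isSelfAdjoint.star_eq] using congrArg star hZA
  have hAv : A = ∑ j, ketbra (v j) := by
    have hconj : Z * (∑ j, ketbra (v j)) * Z = Z * A * Z := by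
      rw [mul_sum_ketbra_mul hZ]
      simp only [hv]
      rw [sum_ketbra_sum_smul, hYY, ← sum_ketbra_mul_mul_sum_ketbra, ← hZA, mul_assoc, ← hAZ,
        mul_assoc]
    exact (hu.mul_left_cancel (hu.mul_right_cancel hconj)).symm
  have hcross : crossGram φ v = Y := by
    ext k j
    have hcomb := (apply_eq_sum_crossGram_smul (hAv ▸ hZA) j).symm.trans (hv j)
    exact Fintype.linearIndependent_iffₛ.1 hφ _ _ hcomb k
  exact ⟨v, hAv, hcross ▸ hY⟩

theorem existsUnique_isPolarFactorization (hφ : LinearIndependent ℂ φ) (hA : A.IsPositive)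
    (hZ : IsSelfAdjoint Z) (hu : IsUnit Z) (hZA : Z * A = (∑ k, ketbra (φ k)) * A) :
    ∃! v, IsPolarFactorization φ A v := by
  obtain ⟨v, hv⟩ := exists_isPolarFactorization hφ hA hZ hu hZA
  exact ⟨v, hv, fun w hw => hw.eq (ContinuousLinearMap.isUnit_iff_bijective.1 hu).injective hZA hv⟩

end Fintype

end PolarFactorization

section Frame

variable {H : Type*} [NormedAddCommGroup H] [InnerProductSpace ℂ H] {m : ℕ} {r : Fin m → ℕ}
  {ψ : Idx r → H}

lemma posDef_G (hψ : LinearIndependent ℂ ψ) : (G ψ).PosDef :=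
  Matrix.posDef_gram_of_linearIndependent hψ

lemma sqrt_G_mul_sqrt_G (ψ : Idx r → H) : CFC.sqrt (G ψ) * CFC.sqrt (G ψ) = G ψ :=
  CFC.sqrt_mul_sqrt_self (G ψ) (Matrix.posSemidef_gram ℂ ψ).nonneg

lemma isUnit_sqrt_G (hψ : LinearIndependent ℂ ψ) : IsUnit (CFC.sqrt (G ψ)) :=
  isUnit_of_mul_isUnit_left ((sqrt_G_mul_sqrt_G ψ).symm ▸ (posDef_G hψ).isUnit)

lemma inner_dualVec (hψ : LinearIndependent ℂ ψ) (c b : Idx r) :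
    inner ℂ (ψ c) (dualVec ψ b) = (1 : Matrix (Idx r) (Idx r) ℂ) c b := by
  have hdet : IsUnit (G ψ).det := (Matrix.isUnit_iff_isUnit_det _).1 (posDef_G hψ).isUnit
  rw [← Matrix.mul_nonsing_inv (G ψ) hdet, Matrix.mul_apply, dualVec, inner_sum]
  simp only [inner_smul_right, G, Matrix.gram_apply, mul_comm]

lemma crossGram_measVec (hψ : LinearIndependent ℂ ψ) (W : Matrix (Idx r) (Idx r) ℂ) :
    crossGram ψ (measVec ψ W) = rootMul ψ W := by
  ext c b
  rw [crossGram, Matrix.of_apply, measVec, inner_sum]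
  simp [inner_smul_right, inner_dualVec hψ, Matrix.one_apply]

lemma crossGram_block_measVec (hψ : LinearIndependent ℂ ψ) (W : Matrix (Idx r) (Idx r) ℂ)
    (i : Fin m) :
    crossGram (fun k => ψ ⟨i, k⟩) (fun j => measVec ψ W ⟨i, j⟩) = X ψ W i := by
  rw [X, ← crossGram_measVec hψ]
  rfl

lemma measVec_bijective (hψ : LinearIndependent ℂ ψ)
    (hspan : Submodule.span ℂ (Set.range ψ) = ⊤) : Function.Bijective (measVec ψ) := by
  refine ⟨fun W W' hW => (isUnit_sqrt_G hψ).mul_left_cancel ?_, fun v => ?_⟩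
  · rw [← rootMul, ← rootMul, ← crossGram_measVec hψ, hW, crossGram_measVec hψ]
  · obtain ⟨s, hs⟩ := isUnit_sqrt_G hψ
    refine ⟨s⁻¹.val * crossGram ψ v, crossGram_injective hspan ?_⟩
    rw [crossGram_measVec hψ, rootMul, ← hs, Units.mul_inv_cancel_left]

lemma mem_unitaryGroup_of_sum_ketbra_measVec (hψ : LinearIndependent ℂ ψ)
    {W : Matrix (Idx r) (Idx r) ℂ} (hW : ∑ b, ketbra (measVec ψ W b) = 1) :
    W ∈ Matrix.unitaryGroup (Idx r) ℂ := by
  have hu := isUnit_sqrt_G hψ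
  have hstar : star (CFC.sqrt (G ψ)) = CFC.sqrt (G ψ) :=
    (CFC.sqrt_nonneg (G ψ)).isSelfAdjoint.star_eq
  have hroot : rootMul ψ W * star (rootMul ψ W) = G ψ := by
    rw [← crossGram_measVec hψ, Matrix.star_eq_conjTranspose, crossGram_mul_conjTranspose, hW]
    rfl
  rw [Matrix.mem_unitaryGroup_iff]
  refine hu.mul_left_cancel (hu.mul_right_cancel ?_)
  calc CFC.sqrt (G ψ) * (W * star W) * CFC.sqrt (G ψ)
      = rootMul ψ W * star (rootMul ψ W) := by rw [rootMul, star_mul, hstar]; simp only [mul_assoc]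
    _ = CFC.sqrt (G ψ) * 1 * CFC.sqrt (G ψ) := by rw [hroot, mul_one, sqrt_G_mul_sqrt_G]

lemma sum_ketbra_sigma {E : Fin m → H →L[ℂ] H} {v : Idx r → H}
    (hv : ∀ i, E i = ∑ j, ketbra (v ⟨i, j⟩)) : ∑ b, ketbra (v b) = ∑ i, E i := by
  simp only [hv, Fintype.sum_sigma]

lemma isAdapted_iff (hψ : LinearIndependent ℂ ψ) {E : Fin m → H →L[ℂ] H} (hE : ∑ i, E i = 1)
    (W : Matrix (Idx r) (Idx r) ℂ) :
    IsAdapted ψ E W ↔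
      ∀ i, IsPolarFactorization (fun k => ψ ⟨i, k⟩) (E i) fun j => measVec ψ W ⟨i, j⟩ := by
  constructor
  · exact fun hW i => ⟨hW.resolves i, crossGram_block_measVec hψ W i ▸ hW.posSemidef i⟩
  · refine fun hW => ⟨mem_unitaryGroup_of_sum_ketbra_measVec hψ ?_, fun i => (hW i).eq_sum,
      fun i => crossGram_block_measVec hψ W i ▸ (hW i).posSemidef⟩
    exact (sum_ketbra_sigma fun i => (hW i).eq_sum).trans hE

theorem existsUnique_isAdapted [CompleteSpace H] [FiniteDimensional ℂ H]
    (hψ : LinearIndependent ℂ ψ) (hspan : Submodule.span ℂ (Set.range ψ) = ⊤)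
    {E : Fin m → H →L[ℂ] H} (hE : IsPOVM E) {Z : H →L[ℂ] H} (hZ : IsSelfAdjoint Z) (hu : IsUnit Z)
    (hZE : ∀ i, Z * E i = (∑ k, ketbra (ψ ⟨i, k⟩)) * E i) : ∃! W, IsAdapted ψ E W := by
  simp only [isAdapted_iff hψ hE.sum_eq]
  refine ((measVec_bijective hψ hspan).existsUnique_iff (p := fun v : Idx r → H => ∀ i,
    IsPolarFactorization (fun k => ψ ⟨i, k⟩) (E i) fun j => v ⟨i, j⟩)).1 ?_
  choose v hv hunique using fun i => existsUnique_isPolarFactorization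
    (hψ.comp (Sigma.mk i) sigma_mk_injective) (hE.pos i) hZ hu (hZE i)
  exact ⟨fun b => v b.1 b.2, hv, fun w hw => funext fun b => congrFun (hunique b.1 _ (hw b.1)) b.2⟩

end Frame

section PrettyGoodMeasurement

variable {H : Type*} [NormedAddCommGroup H] [InnerProductSpace ℂ H] [CompleteSpace H]

lemma mul_self_rpow_neg_half_conj {Y : H →L[ℂ] H} (hY : 0 ≤ Y) (hu : IsUnit Y)
    (A : H →L[ℂ] H) :
    (Y * Y) ^ (-1 / 2 : ℝ) * (Y * A * Y) * (Y * Y) ^ (-1 / 2 : ℝ) = A := by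
  have hpos : IsStrictlyPositive (Y * Y) :=
    IsStrictlyPositive.iff_of_unital.2 ⟨hY.isSelfAdjoint.mul_self_nonneg, hu.mul hu⟩
  have hsqrt : (Y * Y) ^ (1 / 2 : ℝ) = Y := by rw [← CFC.sqrt_eq_rpow, CFC.sqrt_mul_self Y hY]
  have hleft := CFC.rpow_neg_mul_rpow (1 / 2 : ℝ) hpos
  have hright := CFC.rpow_mul_rpow_neg (1 / 2 : ℝ) hpos
  rw [hsqrt, ← neg_div] at hleft hright
  rw [mul_assoc Y, ← mul_assoc, hleft, one_mul, mul_assoc, hright, mul_one]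

variable {m : ℕ} {E σ : Fin m → H →L[ℂ] H} {s : Fin m → ℝ}

lemma eq_pgm_of_smul_eq_conj (hE : ∑ i, E i = 1) {Y : H →L[ℂ] H} (hY : 0 ≤ Y) (hu : IsUnit Y)
    (hσ : ∀ i, (s i : ℂ) • σ i = Y * E i * Y) (i : Fin m) : E i = pgm s σ i := by
  have hsum : ∑ j, (s j : ℂ) • σ j = Y * Y := by
    simp only [hσ]
    rw [← Finset.sum_mul, ← Finset.mul_sum, hE, mul_one]
  rw [pgm, hsum, hσ, mul_self_rpow_neg_half_conj hY hu]

lemma eq_pgm_of_smul_eq_smul_conj (hE : ∑ i, E i = 1) {Z : H →L[ℂ] H} (hZ : Z.IsPositive)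
    (hu : IsUnit Z) {c : ℝ} (hc : 0 < c)
    (hσ : ∀ i, (s i : ℂ) • σ i = (c : ℂ) • (Z * E i * Z)) (i : Fin m) : E i = pgm s σ i := by
  have hsqrt : (√c : ℂ) * √c = c := by rw [← Complex.ofReal_mul, Real.mul_self_sqrt hc.le]
  have hne : (√c : ℂ) ≠ 0 := by exact_mod_cast (Real.sqrt_pos.2 hc).ne'
  have hYu : IsUnit ((√c : ℂ) • Z) := by simpa using hu.smul (Units.mk0 _ hne)
  refine eq_pgm_of_smul_eq_conj hE (Y := (√c : ℂ) • Z) ?_ hYu (fun i => ?_) i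
  · rw [ContinuousLinearMap.nonneg_iff_isPositive]
    exact hZ.smul_of_nonneg (by exact_mod_cast Real.sqrt_nonneg c)
  · rw [hσ, smul_mul_assoc, smul_mul_assoc, mul_smul_comm, smul_smul, hsqrt]

end PrettyGoodMeasurement

section AssociatedEnsemble

variable {H : Type*} [NormedAddCommGroup H] [InnerProductSpace ℂ H] {m : ℕ} {r : Fin m → ℕ}
  {ψ : Idx r → H} {W : Matrix (Idx r) (Idx r) ℂ}

lemma posDef_X {i : Fin m} (hX : (X ψ W i).PosSemidef) (hχ : LinearIndependent ℂ (chi ψ W i)) :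
    (X ψ W i).PosDef := by
  rw [hX.posDef_iff_isUnit, ← Matrix.linearIndependent_cols_iff_isUnit]
  exact LinearIndependent.of_comp (Fintype.linearCombination ℂ fun k => ψ ⟨i, k⟩) hχ

lemma span_chi {i : Fin m} (hψ : LinearIndependent ℂ fun k => ψ ⟨i, k⟩)
    (hχ : LinearIndependent ℂ (chi ψ W i)) :
    Submodule.span ℂ (Set.range (chi ψ W i)) =
      Submodule.span ℂ (Set.range fun k => ψ ⟨i, k⟩) := by
  have : FiniteDimensional ℂ (Submodule.span ℂ (Set.range fun k => ψ ⟨i, k⟩)) :=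
    FiniteDimensional.span_of_finite ℂ (Set.finite_range _)
  refine Submodule.eq_of_le_of_finrank_eq (Submodule.span_le.2 ?_) ?_
  · rintro _ ⟨j, rfl⟩
    exact Submodule.sum_mem _ fun k _ => Submodule.smul_mem _ _ (Submodule.subset_span ⟨k, rfl⟩)
  · rw [finrank_span_eq_card hχ, finrank_span_eq_card hψ]

lemma weight_pos {i : Fin m} (hr : 0 < r i) (hχ : LinearIndependent ℂ (chi ψ W i)) :
    0 < weight ψ W i := by
  have : Nonempty (Fin (r i)) := ⟨⟨0, hr⟩⟩
  exact Finset.sum_pos (fun j _ => pow_pos (norm_pos_iff.2 (hχ.ne_zero j)) 2)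
    Finset.univ_nonempty

lemma supp_sigma [FiniteDimensional ℂ H] {i : Fin m} (hr : 0 < r i)
    (hψ : LinearIndependent ℂ fun k => ψ ⟨i, k⟩) (hχ : LinearIndependent ℂ (chi ψ W i)) :
    supp (sigma ψ W i) = Submodule.span ℂ (Set.range fun k => ψ ⟨i, k⟩) := by
  have hne : ((weight ψ W i : ℂ))⁻¹ ≠ 0 :=
    inv_ne_zero (Complex.ofReal_ne_zero.2 (weight_pos hr hχ).ne')
  rw [sigma, supp_smul hne, supp_sum_ketbra, span_chi hψ hχ]

lemma q_smul_sigma {i : Fin m} (hw : weight ψ W i ≠ 0) :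
    (q ψ W i : ℂ) • sigma ψ W i =
      (((∑ l, weight ψ W l)⁻¹ : ℝ) : ℂ) • ∑ j, ketbra (chi ψ W i j) := by
  have hw' : (weight ψ W i : ℂ) ≠ 0 := Complex.ofReal_ne_zero.2 hw
  rw [sigma, q, smul_smul, div_eq_inv_mul, Complex.ofReal_mul, mul_assoc, mul_inv_cancel₀ hw',
    mul_one]

variable {E : Fin m → H →L[ℂ] H} {Z : H →L[ℂ] H} [FiniteDimensional ℂ H]

lemma IsAdapted.apply_measVec (hW : IsAdapted ψ E W) (hψ : LinearIndependent ℂ ψ)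
    (hZE : ∀ i, Z * E i = (∑ k, ketbra (ψ ⟨i, k⟩)) * E i) (i : Fin m) (j : Fin (r i)) :
    Z (measVec ψ W ⟨i, j⟩) = chi ψ W i j := by
  have hZv := apply_eq_sum_crossGram_smul (φ := fun k => ψ ⟨i, k⟩)
    (v := fun j => measVec ψ W ⟨i, j⟩) (hW.resolves i ▸ hZE i) j
  rwa [crossGram_block_measVec hψ] at hZv

lemma IsAdapted.linearIndependent_chi (hW : IsAdapted ψ E W) (hψ : LinearIndependent ℂ ψ)
    (hcard : Fintype.card (Idx r) = Module.finrank ℂ H) (hE : ∑ i, E i = 1)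
    (hZ : Function.Injective Z) (hZE : ∀ i, Z * E i = (∑ k, ketbra (ψ ⟨i, k⟩)) * E i)
    (i : Fin m) : LinearIndependent ℂ (chi ψ W i) := by
  have hmeas : LinearIndependent ℂ (measVec ψ W) :=
    linearIndependent_of_sum_ketbra_eq_one hcard ((sum_ketbra_sigma hW.resolves).trans hE)
  have himage := (hmeas.comp (Sigma.mk i) sigma_mk_injective).map' (Z : H →ₗ[ℂ] H)
    (LinearMap.ker_eq_bot.2 hZ)
  rwa [← funext (hW.apply_measVec hψ hZE i)]

lemma IsAdapted.eq_pgm [CompleteSpace H] [Nonempty (Fin m)] (hW : IsAdapted ψ E W)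
    (hψ : LinearIndependent ℂ ψ) (hE : ∑ i, E i = 1) (hw : ∀ i, 0 < weight ψ W i)
    (hZ : Z.IsPositive) (hu : IsUnit Z)
    (hZE : ∀ i, Z * E i = (∑ k, ketbra (ψ ⟨i, k⟩)) * E i) (i : Fin m) :
    E i = pgm (q ψ W) (sigma ψ W) i := by
  have hc : 0 < ∑ l, weight ψ W l := Finset.sum_pos (fun l _ => hw l) Finset.univ_nonempty
  refine eq_pgm_of_smul_eq_smul_conj hE hZ hu (inv_pos.2 hc) (fun i => ?_) i
  rw [q_smul_sigma (hw i).ne', hW.resolves i, mul_sum_ketbra_mul hZ.isSelfAdjoint]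
  simp only [hW.apply_measVec hψ hZE]

end AssociatedEnsemble

section LinearlyIndependentStates

variable {H : Type*} [NormedAddCommGroup H] [InnerProductSpace ℂ H] {m : ℕ} {r : Fin m → ℕ}
  {p : Fin m → ℝ} {ρ : Fin m → H →L[ℂ] H} {ψ : Idx r → H}

namespace IsLIEnsemble

lemma isPositive_smul (hP : IsLIEnsemble r p ρ) (i : Fin m) : ((p i : ℂ) • ρ i).IsPositive :=
  (hP.pos i).smul_of_nonneg (by exact_mod_cast (hP.prob_pos i).le)

lemma supp_smul (hP : IsLIEnsemble r p ρ) (i : Fin m) : supp ((p i : ℂ) • ρ i) = supp (ρ i) :=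
  MED.supp_smul (Complex.ofReal_ne_zero.2 (hP.prob_pos i).ne') (ρ i)

lemma nonempty (hP : IsLIEnsemble r p ρ) : Nonempty (Fin m) := by
  by_contra h
  rw [not_nonempty_iff] at h
  simpa using hP.prob_sum

lemma rank_pos [FiniteDimensional ℂ H] (hP : IsLIEnsemble r p ρ) (i : Fin m) : 0 < r i := by
  rw [← hP.rank_eq i, Module.finrank_pos_iff, Submodule.nontrivial_iff_ne_bot]
  intro hbot
  have htr := hP.trace_one i
  rw [tr, LinearMap.range_eq_bot.1 hbot, map_zero] at htr
  exact zero_ne_one htr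

lemma card_idx [FiniteDimensional ℂ H] (hP : IsLIEnsemble r p ρ) :
    Fintype.card (Idx r) = Module.finrank ℂ H := by
  have hint := DirectSum.isInternal_submodule_of_iSupIndep_of_iSup_eq_top hP.indep hP.span
  rw [Module.finrank_eq_card_basis
    (hint.collectedBasis fun i => Module.finBasis ℂ (supp (ρ i)))]
  simp [hP.rank_eq]

lemma q_sigma [FiniteDimensional ℂ H] (hP : IsLIEnsemble r p ρ) {W : Matrix (Idx r) (Idx r) ℂ}
    (hw : ∀ i, 0 < weight ψ W i) (hs : ∀ i, supp (sigma ψ W i) = supp (ρ i)) :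
    IsLIEnsemble r (q ψ W) (sigma ψ W) := by
  have := hP.nonempty
  have hc : 0 < ∑ l, weight ψ W l := Finset.sum_pos (fun l _ => hw l) Finset.univ_nonempty
  exact {
    prob_pos i := div_pos (hw i) hc
    prob_sum := by simp only [q, ← Finset.sum_div, div_self hc.ne']
    pos i := (isPositive_sum_ketbra _).smul_of_nonneg <| by
      rw [← Complex.ofReal_inv]
      exact_mod_cast (inv_pos.2 (hw i)).le
    trace_one i := by
      rw [sigma, tr_smul, tr_sum]
      simp only [tr_ketbra]
      rw [← Complex.ofReal_sum, ← weight,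
        inv_mul_cancel₀ (Complex.ofReal_ne_zero.2 (hw i).ne')]
    rank_eq i := by rw [hs i, hP.rank_eq i]
    indep := by simpa only [hs] using hP.indep
    span := by simpa only [hs] using hP.span }

end IsLIEnsemble

lemma successProb_eq (p : Fin m → ℝ) (ρ E : Fin m → H →L[ℂ] H) :
    successProb p ρ E = ∑ i, (tr (((p i : ℂ) • ρ i) * E i)).re := by
  simp only [successProb, smul_mul_assoc, tr_smul, Complex.re_ofReal_mul]

variable [FiniteDimensional ℂ H]

namespace IsDecomposition

lemma supp_eq (hP : IsLIEnsemble r p ρ) (hψ : IsDecomposition p ρ ψ) (i : Fin m) :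
    supp (ρ i) = Submodule.span ℂ (Set.range fun k => ψ ⟨i, k⟩) := by
  rw [← hP.supp_smul i, hψ i, supp_sum_ketbra]

lemma span_eq_top (hP : IsLIEnsemble r p ρ) (hψ : IsDecomposition p ρ ψ) :
    Submodule.span ℂ (Set.range ψ) = ⊤ := by
  rw [eq_top_iff, ← hP.span]
  refine iSup_le fun i => ?_
  rw [hψ.supp_eq hP i]
  exact Submodule.span_mono (Set.range_comp_subset_range (Sigma.mk i) ψ)

lemma linearIndependent (hP : IsLIEnsemble r p ρ) (hψ : IsDecomposition p ρ ψ) :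
    LinearIndependent ℂ ψ :=
  linearIndependent_of_top_le_span_of_card_eq_finrank (hψ.span_eq_top hP).ge hP.card_idx

end IsDecomposition

lemma IsOptimalPOVM.exists_lagrange [CompleteSpace H] {E : Fin m → H →L[ℂ] H}
    (hE : IsOptimalPOVM p ρ E) (hP : IsLIEnsemble r p ρ) :
    ∃ Z : H →L[ℂ] H, Z.IsPositive ∧ IsUnit Z ∧ ∀ i, Z * E i = ((p i : ℂ) • ρ i) * E i := by
  have := hP.nonempty
  obtain ⟨Z, hZ⟩ := exists_isLagrangeOperator (fun i => (hP.isPositive_smul i).isSelfAdjoint) hE.1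
    fun F hF => by simpa only [successProb_eq] using hE.2 F hF
  refine ⟨Z, hZ.isPositive hP.isPositive_smul, hZ.isUnit hP.isPositive_smul ?_, hZ.mul_eq⟩
  simpa only [hP.supp_smul] using hP.span

end LinearlyIndependentStates

end MED

theorem mainTheorem3 {H : Type*} [NormedAddCommGroup H] [InnerProductSpace ℂ H] [CompleteSpace H]
    [FiniteDimensional ℂ H] {m : ℕ} (r : Fin m → ℕ) (p : Fin m → ℝ) (ρ : Fin m → H →L[ℂ] H)
    (hP : MED.IsLIEnsemble r p ρ) (E : Fin m → H →L[ℂ] H) (hE : MED.IsOptimalPOVM p ρ E)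
    (ψ : MED.Idx r → H) (hψ : MED.IsDecomposition p ρ ψ) :
    (∃! W, MED.IsAdapted ψ E W) ∧
    ∀ W, MED.IsAdapted ψ E W →
      (∀ i, (MED.X ψ W i).PosDef) ∧
      MED.IsLIEnsemble r (MED.q ψ W) (MED.sigma ψ W) ∧
      (∀ i, MED.supp ((MED.q ψ W i : ℂ) • MED.sigma ψ W i) = MED.supp ((p i : ℂ) • ρ i)) ∧
      (∀ i, E i = MED.pgm (MED.q ψ W) (MED.sigma ψ W) i) := by
  have := hP.nonempty
  have hli := hψ.linearIndependent hP
  have hsum := hE.1.sum_eq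
  obtain ⟨Z, hZ, hu, hZE⟩ := hE.exists_lagrange hP
  simp only [hψ _] at hZE
  refine ⟨MED.existsUnique_isAdapted hli (hψ.span_eq_top hP) hE.1 hZ.isSelfAdjoint hu hZE,
    fun W hW => ?_⟩
  have hχ := hW.linearIndependent_chi hli hP.card_idx hsum
    (ContinuousLinearMap.isUnit_iff_bijective.1 hu).injective hZE
  have hw : ∀ i, 0 < MED.weight ψ W i := fun i => MED.weight_pos (hP.rank_pos i) (hχ i)
  have hsupp : ∀ i, MED.supp (MED.sigma ψ W i) = MED.supp (ρ i) := fun i =>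
    (MED.supp_sigma (hP.rank_pos i) (hli.comp (Sigma.mk i) sigma_mk_injective) (hχ i)).trans
      (hψ.supp_eq hP i).symm
  have hens := hP.q_sigma hw hsupp
  refine ⟨fun i => MED.posDef_X (hW.posSemidef i) (hχ i), hens, fun i => ?_,
    hW.eq_pgm hli hsum hw hZ hu hZE⟩
  rw [hens.supp_smul, hP.supp_smul, hsupp]
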